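/- Fix numbers $O,S$ of outputs and inputs and a length $L\ge 1$. The arrow-of-time polytope $P_L^{O,S}$ is the set of all $p(a_1\dots a_L|x_1\dots x_L)\ge 0$ with $\sum_{a_1,\dots,a_L}p(a_1\dots a_L|x_1\dots x_L)=1$ for all inputs and such that, for every $l$, the marginal $\sum_{a_{l+1},\dots,a_L}p(a_1\dots a_L|x_1\dots x_L)$ does not depend on $x_{l+1},\dots,x_L$. A $d$-dimensional quantum realization of $p$ with time-independent instruments consists of a density matrix $\rho$ on $\mathbb C^d$ and completely positive maps $\mathcal I_{a|x}$ on $M_d(\mathbb C)$ (Heisenberg picture) with $\sum_a\mathcal I_{a|x}(1)=1$ for every $x$, such that $p(a_1\dots a_L|x_1\dots x_L)=\mathrm{tr}[\rho\,\mathcal I_{a_1|x_1}\circ\dots\circ\mathcal I_{a_L|x_L}(1)]$ for all outputs and inputs. Consider the $S$-ary tree whose nodes $(l,k)$, $1\le l\le L$, $1\le k\le S^{l-1}$, are the input words $x_1\dots x_{l-1}$. An assignment $\Gamma$ of tuples $\Gamma_{l,k}=(z_1,\dots,z_S)\in\{0,\dots,O-1\}^S$ to the nodes describes the deterministic correlation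 in which, at the node $(l,k)$ and for the input $x$, the output is the $x$-th entry of $\Gamma_{l,k}$. For $r\le L-l$ let $T_{l,k}^r$ be the subtree of tuples of all nodes reached from $(l,k)$ by at most $r$ further inputs. The nodes $(l,k)$ and $(l',k')$ have equivalent futures if $T_{l,k}^r=T_{l',k'}^r$ for $r=\min\{L-l,L-l'\}$. **Theorem.** Let $p$ be an extreme point of $P_L^{O,S}$. Then $p$ is the deterministic correlation described by a unique tree $\Gamma$ of tuples, and the minimal $d$ for which $p$ has a $d$-dimensional quantum realization with time-independent instruments equals the number $N$ of inequivalent futures in the history $T_{1,1}=T_{1,1}^{L-1}$, i.e. the maximal number of nodes of the tree whose futures are pairwise inequivalent. Moreover: 1. In every quantum realization of $p$ with time-independent instruments, of any dimension, the state $\rho_{l,k}$ of the system at each node $(l,k)$, i.e. after the inputs leading to $(l,k)$ and the corresponding deterministic outputs, is a density matrix, and $\rho_{l,k}$ and $\rho_{l',k'}$ have orthogonal ranges whenever $(l,k)$ and $(l',k')$ have inequivalent futures. 2. In dimension $N$, $p$ is realized by a classical (diagonal) measure-and-prepare model: the initial state is a vector $|j_0\rangle\langle j_0|$ of the standard basis,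 and there are functions $\mathrm{out}$ and $\mathrm{next}$ such that $\mathcal I_{a|x}(X)=\sum_{j:\,\mathrm{out}(j,x)=a}|j\rangle\langle \mathrm{next}(j,x)|\,X\,|\mathrm{next}(j,x)\rangle\langle j|$. -/

import Mathlib

/-!
Sequential measurements with `O` outputs, `S` inputs and sequence length `L`: the arrow-of-time
polytope, time-independent quantum models (finite-state machines), and the tree of outcome tuples of
a deterministic point with its futures.
-/

noncomputable section

namespace ArrowOfTime

/-! ### The arrow-of-time polytope -/

/-- A table `p a x`, to be read `p(a₁ … a_L | x₁ … x_L)`. -/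
abbrev Correlation (O S L : ℕ) : Type := (Fin L → Fin O) → (Fin L → Fin S) → ℝ

/-- The probability `∑_{a_{l+1}, …, a_L} p(a₁ … a_L | x)` of the first `l` outcomes of `a`
when the whole input sequence is `x`. -/
def marginal {O S L : ℕ} (p : Correlation O S L) (l : ℕ) (a : Fin L → Fin O)
    (x : Fin L → Fin S) : ℝ :=
  ∑ b : Fin L → Fin O with ∀ i : Fin L, (i : ℕ) < l → b i = a i, p b x

/-- The arrow-of-time polytope `P_L^{O,S}`: positivity, normalization, and independence of the
statistics of the first `l` outcomes from all inputs later than step `l`. -/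
def polytope (O S L : ℕ) : Set (Correlation O S L) :=
  {p | (∀ a x, 0 ≤ p a x) ∧ (∀ x, ∑ a, p a x = 1) ∧
    ∀ (l : ℕ) (a : Fin L → Fin O) (x x' : Fin L → Fin S),
      (∀ i : Fin L, (i : ℕ) < l → x i = x' i) → marginal p l a x = marginal p l a x'}

/-! ### Deterministic points as trees of tuples -/

/-- Nodes of the tree. A node `(l, k)` at time step `l ∈ {1, …, L}` is written as the word of the
`l - 1` inputs that lead to it; there are `S ^ (l - 1)` such words. -/
abbrev Node (S L : ℕ) : Type := {w : List (Fin S) // w.length < L}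

/-- A tree assigns to every node `(l, k)` the tuple `Γ_{l,k} = (z₁, …, z_S)` of outcomes. -/
abbrev Tree (O S L : ℕ) : Type := Node S L → Fin S → Fin O

namespace Tree

variable {O S L : ℕ}

/-- The node reached after the first `i` inputs of the sequence `x`. -/
def nodeOf (x : Fin L → Fin S) (i : Fin L) : Node S L :=
  ⟨(List.ofFn x).take i, (List.length_take_le _ _).trans_lt i.isLt⟩

/-- The deterministic correlation described by the tree `Γ`: at every time step the outcome is the
entry, for the current input, of the tuple at the current node. -/
def toCorrelation (Γ : Tree O S L) : Correlation O S L := by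
  classical
  exact fun a x => if ∀ i : Fin L, a i = Γ (nodeOf x i) (x i) then 1 else 0

/-- The length `L - l` of the (full) future of a node `(l, k)`. -/
def futureLength (w : Node S L) : ℕ := L - (w.1.length + 1)

/-- The `r`-length future `T_{l,k}^r` of the node `w = (l, k)`, for `r ≤ L - l`: the tuples of
all nodes that are reached from `w` by at most `r` further inputs, placed in the tree. -/
def future (Γ : Tree O S L) (w : Node S L) (r : ℕ) (hr : r ≤ futureLength w) :
    {u : List (Fin S) // u.length ≤ r} → Fin S → Fin O :=
  fun u => Γ ⟨w.1 ++ u.1, by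
    have h1 := w.2
    have h2 := u.2
    unfold futureLength at hr
    rw [List.length_append]
    omega⟩

/-- Two nodes `(l, k)`, `(l', k')` have equivalent futures if `T_{l,k}^r = T_{l',k'}^r` for
`r = min {L - l, L - l'}`. (This relation is reflexive and symmetric, in general not transitive.) -/
def EquivalentFutures (Γ : Tree O S L) (w w' : Node S L) : Prop :=
  Γ.future w (min (futureLength w) (futureLength w')) (min_le_left _ _) =
    Γ.future w' (min (futureLength w) (futureLength w')) (min_le_right _ _)

/-- The number of inequivalent futures: the largest number of nodes of the tree whose futures are
pairwise inequivalent. (The set of these numbers is bounded, see `isGreatest_numFutures`.) -/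
def numFutures (Γ : Tree O S L) : ℕ :=
  sSup {n : ℕ | ∃ s : Finset (Node S L), s.card = n ∧
    (s : Set (Node S L)).Pairwise fun w w' => ¬ Γ.EquivalentFutures w w'}

theorem isGreatest_numFutures (Γ : Tree O S L) :
    IsGreatest {n : ℕ | ∃ s : Finset (Node S L), s.card = n ∧
      (s : Set (Node S L)).Pairwise fun w w' => ¬ Γ.EquivalentFutures w w'} Γ.numFutures := by
  have hfin : Finite (Node S L) := (List.finite_length_lt (Fin S) L).to_subtype
  have hb : BddAbove {n : ℕ | ∃ s : Finset (Node S L), s.card = n ∧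
      (s : Set (Node S L)).Pairwise fun w w' => ¬ Γ.EquivalentFutures w w'} := by
    have := Fintype.ofFinite (Node S L)
    refine ⟨Fintype.card (Node S L), ?_⟩
    rintro n ⟨s, rfl, -⟩
    exact s.card_le_univ
  exact ⟨Nat.sSup_mem ⟨0, ∅, by simp⟩ hb, fun n hn => le_csSup hb hn⟩

/-- The (outcome, input) pairs recorded on the way from the root to the node `w`. -/
def record (Γ : Tree O S L) (w : Node S L) : List (Fin O × Fin S) :=
  List.ofFn fun i : Fin w.1.length =>
    (Γ ⟨w.1.take i, (List.length_take_le _ _).trans_lt (i.isLt.trans w.2)⟩ (w.1.get i), w.1.get i)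

end Tree

/-! ### Time-independent quantum models -/

section Quantum

open scoped ComplexOrder MatrixOrder Matrix.Norms.L2Operator Matrix CStarAlgebra

/-- Density matrices of dimension `d`. -/
def IsDensityMatrix {d : ℕ} (ρ : Matrix (Fin d) (Fin d) ℂ) : Prop :=
  ρ.PosSemidef ∧ ρ.trace = 1

/-- A `d`-dimensional quantum finite-state machine: an initial state and, for every input `x`,
one quantum instrument `{I_{a|x}}_a` in the Heisenberg picture, used at all time steps. -/
structure Machine (O S d : ℕ) where
  /-- the initial state -/
  ρ : Matrix (Fin d) (Fin d) ℂ
  isDensityMatrix : IsDensityMatrix ρ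
  /-- the completely positive maps `I_{a|x}` -/
  I : Fin O → Fin S → Matrix (Fin d) (Fin d) ℂ →CP Matrix (Fin d) (Fin d) ℂ
  sum_unital : ∀ x, ∑ a, I a x 1 = 1

namespace Machine

variable {O S d : ℕ}

/-- `I_{a₁|x₁} ∘ ⋯ ∘ I_{a_n|x_n}` applied to `X`, for the record `(a₁, x₁), …, (a_n, x_n)`. -/
def iterate (M : Machine O S d) (h : List (Fin O × Fin S)) (X : Matrix (Fin d) (Fin d) ℂ) :
    Matrix (Fin d) (Fin d) ℂ :=
  h.foldr (fun ax Y => M.I ax.1 ax.2 Y) X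

/-- The machine generates `p`:
`p(a₁ … a_L | x₁ … x_L) = tr[ρ I_{a₁|x₁} ∘ ⋯ ∘ I_{a_L|x_L}(1)]`. -/
def Realizes {L : ℕ} (M : Machine O S d) (p : Correlation O S L) : Prop :=
  ∀ a x, (p a x : ℂ) = (M.ρ * M.iterate (List.ofFn fun i => (a i, x i)) 1).trace

/-- The (unnormalized) state of the machine after the record `h`, i.e. the matrix `σ` with
`tr[σ X] = tr[ρ I_{a₁|x₁} ∘ ⋯ ∘ I_{a_n|x_n}(X)]` for all `X`; its trace is the probability
of the record. -/
def stateAfter (M : Machine O S d) (h : List (Fin O × Fin S)) : Matrix (Fin d) (Fin d) ℂ :=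
  Matrix.of fun i j => (M.ρ * M.iterate h (Matrix.single j i 1)).trace

/-- The machine is a classical (diagonal) deterministic measure-and-prepare model in the standard
basis: it starts in a basis state `|j₀⟩⟨j₀|`; on input `x`, the basis state `|j⟩` emits the
outcome `out j x` and is replaced by the basis state `|next j x⟩`. That is, `I_{a|x}` has the Kraus
operators `|next j x⟩⟨j|` for all `j` with `out j x = a`. -/
def IsClassicalMeasurePrepare (M : Machine O S d) : Prop :=
  ∃ (j₀ : Fin d) (out : Fin d → Fin S → Fin O) (next : Fin d → Fin S → Fin d),
    M.ρ = Matrix.single j₀ j₀ 1 ∧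
    ∀ a x X, M.I a x X = ∑ j : Fin d with out j x = a,
      (Matrix.single (next j x) j (1 : ℂ))ᴴ * X * Matrix.single (next j x) j (1 : ℂ)

end Machine

/-- Two positive matrices have orthogonal ranges. -/
def OrthogonalRanges {d : ℕ} (σ τ : Matrix (Fin d) (Fin d) ℂ) : Prop :=
  ∀ u v : Fin d → ℂ, star (σ *ᵥ u) ⬝ᵥ (τ *ᵥ v) = 0

end Quantum

end ArrowOfTime

end

noncomputable section

namespace ArrowOfTime

open scoped ComplexOrder MatrixOrder Matrix.Norms.L2Operator Matrix CStarAlgebra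

/-! ### Positive matrices -/

section Positive

variable {d : ℕ}

/-! Extreme points are deterministic by conditioning. If the first `l` outcomes are fixed by the
inputs but the next one is random, conditioning on one of its values and on the complement, only for
inputs with the given beginning, stays in the polytope (`conditioned_mem_polytope`) and splits `p`
properly. Causality then turns a deterministic `p` into a tree.

Lower bound: inequivalent nodes have a common continuation on which their outcomes differ. The
instruments do not depend on time, so one sequential measurement can be applied at both nodes, and
it tells the two states apart with certainty. Hence their ranges are orthogonal
(`orthogonalRanges_of_effects`), and there is room for at most `d` such states.

Upper bound: equivalence of futures is not transitive, so there are no classes to serve as states.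
Instead, a maximum inequivalent set of least total depth covers every node by one that is no deeper
and whose future extends the given one (`exists_covering`). Such nodes serve as the basis states of
a classical machine. -/

theorem trace_mul_eq_trace_conjTranspose_mul_self (B D : Matrix (Fin d) (Fin d) ℂ) :
    ((star B * B) * (star D * D)).trace = ((B * star D)ᴴ * (B * star D)).trace := by
  simp only [Matrix.star_eq_conjTranspose, Matrix.conjTranspose_mul,
    Matrix.conjTranspose_conjTranspose]
  rw [← mul_assoc, Matrix.trace_mul_comm]
  simp only [mul_assoc]

theorem trace_mul_nonneg {A C : Matrix (Fin d) (Fin d) ℂ} (hA : 0 ≤ A) (hC : 0 ≤ C) :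
    0 ≤ (A * C).trace := by
  obtain ⟨B, rfl⟩ := CStarAlgebra.nonneg_iff_eq_star_mul_self.mp hA
  obtain ⟨D, rfl⟩ := CStarAlgebra.nonneg_iff_eq_star_mul_self.mp hC
  rw [trace_mul_eq_trace_conjTranspose_mul_self]
  exact (Matrix.posSemidef_conjTranspose_mul_self _).trace_nonneg

/-- For `A = B⋆B` and `C = D⋆D` the trace is the squared Hilbert–Schmidt norm of `BD⋆`. -/
theorem mul_eq_zero_of_trace_mul_eq_zero {A C : Matrix (Fin d) (Fin d) ℂ} (hA : 0 ≤ A)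
    (hC : 0 ≤ C) (h : (A * C).trace = 0) : A * C = 0 := by
  obtain ⟨B, rfl⟩ := CStarAlgebra.nonneg_iff_eq_star_mul_self.mp hA
  obtain ⟨D, rfl⟩ := CStarAlgebra.nonneg_iff_eq_star_mul_self.mp hC
  rw [trace_mul_eq_trace_conjTranspose_mul_self,
    Matrix.trace_conjTranspose_mul_self_eq_zero_iff] at h
  calc star B * B * (star D * D) = star B * (B * star D) * D := by simp only [mul_assoc]
    _ = 0 := by rw [h]; simp

theorem trace_mul_le_trace_mul {A C C' : Matrix (Fin d) (Fin d) ℂ} (hA : 0 ≤ A) (hC : C ≤ C') :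
    (A * C).trace ≤ (A * C').trace := by
  have := trace_mul_nonneg hA (sub_nonneg.2 hC)
  rwa [mul_sub, Matrix.trace_sub, sub_nonneg] at this

theorem eq_mul_of_trace_mul_eq_trace {A E : Matrix (Fin d) (Fin d) ℂ} (hA : 0 ≤ A) (hE : E ≤ 1)
    (h : (A * E).trace = A.trace) : A = A * E := by
  have := mul_eq_zero_of_trace_mul_eq_zero hA (sub_nonneg.2 hE)
    (by rw [mul_sub, Matrix.trace_sub, h, mul_one, sub_self])
  rwa [mul_sub, mul_one, sub_eq_zero] at this

/-- States that are perfectly distinguished by two effects have orthogonal ranges. -/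
theorem orthogonalRanges_of_effects {σ τ E F : Matrix (Fin d) (Fin d) ℂ} (hσ : 0 ≤ σ) (hτ : 0 ≤ τ)
    (hE : 0 ≤ E) (hF : 0 ≤ F) (hEF : E + F ≤ 1) (hσE : (σ * E).trace = σ.trace)
    (hτF : (τ * F).trace = τ.trace) : OrthogonalRanges σ τ := by
  have h1 : σ = σ * E := eq_mul_of_trace_mul_eq_trace hσ ((le_add_of_nonneg_right hF).trans hEF) hσE
  -- `F` already takes the full trace of `τ`, so `E + F ≤ 1` leaves nothing for `E`.
  have h2 : τ * E = 0 := by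
    refine mul_eq_zero_of_trace_mul_eq_zero hτ hE (le_antisymm ?_ (trace_mul_nonneg hτ hE))
    have := trace_mul_le_trace_mul hτ hEF
    rwa [mul_add, Matrix.trace_add, hτF, mul_one, add_le_iff_nonpos_left] at this
  have hEτ : E * τ = 0 := by
    have := congrArg Matrix.conjTranspose h2
    rwa [Matrix.conjTranspose_mul, (Matrix.nonneg_iff_posSemidef.1 hE).isHermitian.eq, (Matrix.nonneg_iff_posSemidef.1 hτ).isHermitian.eq,
      Matrix.conjTranspose_zero] at this
  intro u v
  rw [Matrix.star_mulVec, ← Matrix.dotProduct_mulVec, Matrix.mulVec_mulVec,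
    (Matrix.nonneg_iff_posSemidef.1 hσ).isHermitian.eq, h1, mul_assoc, hEτ]
  simp

/-- Nonzero matrices with pairwise orthogonal ranges are at most as many as the dimension. -/
theorem card_le_of_orthogonalRanges {ι : Type*} [Fintype ι] (σ : ι → Matrix (Fin d) (Fin d) ℂ)
    (h0 : ∀ i, σ i ≠ 0) (h : Pairwise fun i j => OrthogonalRanges (σ i) (σ j)) :
    Fintype.card ι ≤ d := by
  have hu : ∀ i, ∃ u : Fin d → ℂ, σ i *ᵥ u ≠ 0 := by
    intro i
    by_contra! hi
    exact h0 i (Matrix.ext_of_mulVec_single fun j => by rw [hi, Matrix.zero_mulVec])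
  choose u hu using hu
  let v : ι → EuclideanSpace ℂ (Fin d) := fun i => WithLp.toLp 2 (σ i *ᵥ u i)
  have hv : LinearIndependent ℂ v := by
    refine linearIndependent_of_ne_zero_of_inner_eq_zero (𝕜 := ℂ) (fun i hi => hu i ?_) ?_
    · simpa [v] using hi
    · intro i j hij
      have := h hij (u i) (u j)
      rw [dotProduct_comm] at this
      simpa [v, EuclideanSpace.inner_eq_star_dotProduct] using this
  simpa using hv.fintype_card_le_finrank

end Positive

/-! ### Effects and states of a machine -/

namespace Machine

variable {O S d : ℕ} (M : Machine O S d)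

@[simp] theorem iterate_nil (X : Matrix (Fin d) (Fin d) ℂ) : M.iterate [] X = X := rfl

@[simp] theorem iterate_cons (ax : Fin O × Fin S) (h : List (Fin O × Fin S))
    (X : Matrix (Fin d) (Fin d) ℂ) :
    M.iterate (ax :: h) X = M.I ax.1 ax.2 (M.iterate h X) := rfl

theorem iterate_append (h h' : List (Fin O × Fin S)) (X : Matrix (Fin d) (Fin d) ℂ) :
    M.iterate (h ++ h') X = M.iterate h (M.iterate h' X) := by
  simp [iterate, List.foldr_append]

theorem instrument_mono (a : Fin O) (x : Fin S) {X Y : Matrix (Fin d) (Fin d) ℂ} (h : X ≤ Y) :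
    M.I a x X ≤ M.I a x Y :=
  OrderHomClass.mono (M.I a x) h

theorem instrument_nonneg (a : Fin O) (x : Fin S) {X : Matrix (Fin d) (Fin d) ℂ} (h : 0 ≤ X) :
    0 ≤ M.I a x X := by
  simpa using M.instrument_mono a x h

theorem instrument_add_le_one {a a' : Fin O} (h : a ≠ a') (x : Fin S) :
    M.I a x 1 + M.I a' x 1 ≤ 1 := by
  rw [← Finset.sum_pair (f := fun a => M.I a x 1) h]
  refine le_of_le_of_eq ?_ (M.sum_unital x)
  exact Finset.sum_le_sum_of_subset_of_nonneg (Finset.subset_univ _)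
    fun a _ _ => M.instrument_nonneg a x zero_le_one

theorem instrument_le_one (a : Fin O) (x : Fin S) : M.I a x 1 ≤ 1 := by
  refine le_of_le_of_eq ?_ (M.sum_unital x)
  exact Finset.single_le_sum (f := fun a => M.I a x 1)
    (fun a _ => M.instrument_nonneg a x zero_le_one) (Finset.mem_univ a)

theorem iterate_mono (h : List (Fin O × Fin S)) {X Y : Matrix (Fin d) (Fin d) ℂ} (hXY : X ≤ Y) :
    M.iterate h X ≤ M.iterate h Y := by
  induction h with
  | nil => exact hXY
  | cons ax h ih => exact M.instrument_mono _ _ ih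

/-- The maps `I_{a₁|x₁} ∘ ⋯ ∘ I_{a_n|x_n}` as linear maps. -/
def iterateLinear (h : List (Fin O × Fin S)) :
    Matrix (Fin d) (Fin d) ℂ →ₗ[ℂ] Matrix (Fin d) (Fin d) ℂ where
  toFun := M.iterate h
  map_add' X Y := by
    induction h with
    | nil => rfl
    | cons ax h ih => simp [ih]
  map_smul' c X := by
    induction h with
    | nil => rfl
    | cons ax h ih => simp [ih]

theorem iterate_zero (h : List (Fin O × Fin S)) : M.iterate h 0 = 0 :=
  map_zero (M.iterateLinear h)

theorem iterate_nonneg (h : List (Fin O × Fin S)) {X : Matrix (Fin d) (Fin d) ℂ} (hX : 0 ≤ X) :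
    0 ≤ M.iterate h X := by
  simpa [iterate_zero] using M.iterate_mono h hX

theorem iterate_le_one (h : List (Fin O × Fin S)) : M.iterate h 1 ≤ 1 := by
  induction h with
  | nil => exact le_rfl
  | cons ax h ih => exact (M.instrument_mono _ _ ih).trans (M.instrument_le_one _ _)

/-- Distinct records with the same inputs have effects that add up to at most `1`. -/
theorem iterate_add_iterate_le_one {h h' : List (Fin O × Fin S)}
    (hs : h.map Prod.snd = h'.map Prod.snd) (hne : h ≠ h') :
    M.iterate h 1 + M.iterate h' 1 ≤ 1 := by
  induction h generalizing h' with
  | nil =>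
    cases h' with
    | nil => exact absurd rfl hne
    | cons _ _ => simp at hs
  | cons ax h ih =>
    cases h' with
    | nil => simp at hs
    | cons ax' h' =>
      obtain ⟨a, x⟩ := ax
      obtain ⟨a', x'⟩ := ax'
      obtain ⟨rfl, ht⟩ : x = x' ∧ h.map Prod.snd = h'.map Prod.snd := by simpa using hs
      simp only [iterate_cons]
      -- Equal first outcomes reduce to the tails under a common positive map; different ones give
      -- two effects of a single instrument.
      by_cases ha : a = a'
      · subst ha
        rw [← map_add]
        exact (M.instrument_mono _ _ (ih ht fun h => hne (by rw [h]))).trans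
          (M.instrument_le_one _ _)
      · exact (add_le_add (M.instrument_mono _ _ (M.iterate_le_one h))
          (M.instrument_mono _ _ (M.iterate_le_one h'))).trans (M.instrument_add_le_one ha x)

theorem state_nonneg : 0 ≤ M.ρ := M.isDensityMatrix.1.nonneg

/-- Both sides are linear in `X` and agree on matrix units by the definition of `stateAfter`. -/
theorem trace_stateAfter_mul (h : List (Fin O × Fin S)) (X : Matrix (Fin d) (Fin d) ℂ) :
    (M.stateAfter h * X).trace = (M.ρ * M.iterate h X).trace := by
  let f : Matrix (Fin d) (Fin d) ℂ →ₗ[ℂ] ℂ :=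
    Matrix.traceLinearMap (Fin d) ℂ ℂ ∘ₗ LinearMap.mulLeft ℂ (M.stateAfter h)
  let g : Matrix (Fin d) (Fin d) ℂ →ₗ[ℂ] ℂ :=
    Matrix.traceLinearMap (Fin d) ℂ ℂ ∘ₗ LinearMap.mulLeft ℂ M.ρ ∘ₗ M.iterateLinear h
  have : f = g := by
    refine Matrix.ext_linearMap _ fun i j => LinearMap.ext_ring ?_
    simp [f, g, iterateLinear, stateAfter, Matrix.trace_mul_single]
  exact LinearMap.congr_fun this X

theorem trace_stateAfter (h : List (Fin O × Fin S)) :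
    (M.stateAfter h).trace = (M.ρ * M.iterate h 1).trace := by
  simpa using M.trace_stateAfter_mul h 1

theorem stateAfter_nonneg (h : List (Fin O × Fin S)) : 0 ≤ M.stateAfter h := by
  refine Matrix.PosSemidef.nonneg ?_
  have key : ∀ v : Fin d → ℂ, 0 ≤ star v ⬝ᵥ (M.stateAfter h *ᵥ v) := by
    intro v
    have := trace_mul_nonneg M.state_nonneg
      (M.iterate_nonneg h (Matrix.posSemidef_vecMulVec_self_star v).nonneg)
    rwa [← trace_stateAfter_mul, Matrix.mul_vecMulVec, Matrix.trace_vecMulVec,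
      dotProduct_comm] at this
  -- Over `ℂ` a nonnegative quadratic form is enough: self-adjointness comes for free.
  rw [← Matrix.isPositive_toEuclideanLin_iff, LinearMap.isPositive_iff_complex]
  intro v
  obtain ⟨hre, him⟩ := Complex.nonneg_iff.1 (key v.ofLp)
  have h1 : inner ℂ (Matrix.toEuclideanLin (M.stateAfter h) v) v =
      (starRingEnd ℂ) (star v.ofLp ⬝ᵥ (M.stateAfter h *ᵥ v.ofLp)) := by
    rw [← inner_conj_symm, EuclideanSpace.inner_eq_star_dotProduct, dotProduct_comm]
    rfl
  rw [h1]
  exact ⟨Complex.ext (by simp) (by simp [← him]), by simpa using hre⟩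

theorem trace_append_le (h h' : List (Fin O × Fin S)) :
    (M.ρ * M.iterate (h ++ h') 1).trace ≤ (M.ρ * M.iterate h 1).trace := by
  rw [iterate_append]
  exact trace_mul_le_trace_mul M.state_nonneg (M.iterate_mono h (M.iterate_le_one h'))

theorem trace_iterate_le_one (h : List (Fin O × Fin S)) : (M.ρ * M.iterate h 1).trace ≤ 1 := by
  simpa [M.isDensityMatrix.2] using trace_mul_le_trace_mul M.state_nonneg (M.iterate_le_one h)

end Machine

/-! ### Records along the branches of a tree -/

/-- The (outcome, input) pairs recorded when, starting at the word `w`, the inputs `t` follow and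
the outcomes are read off from `G`. -/
def path {O S : ℕ} (G : List (Fin S) → Fin S → Fin O) :
    List (Fin S) → List (Fin S) → List (Fin O × Fin S)
  | _, [] => []
  | w, s :: t => (G w s, s) :: path G (w ++ [s]) t

section Path

variable {O S : ℕ} (G : List (Fin S) → Fin S → Fin O)

theorem path_append (w t t' : List (Fin S)) :
    path G w (t ++ t') = path G w t ++ path G (w ++ t) t' := by
  induction t generalizing w with
  | nil => simp [path]
  | cons s t ih => simp [path, ih]

theorem map_snd_path (w t : List (Fin S)) : (path G w t).map Prod.snd = t := by
  induction t generalizing w with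
  | nil => rfl
  | cons s t ih => simp [path, ih]

theorem path_ofFn (w : List (Fin S)) {n : ℕ} (x : Fin n → Fin S) :
    path G w (List.ofFn x) =
      List.ofFn fun i : Fin n => (G (w ++ (List.ofFn x).take i) (x i), x i) := by
  induction n generalizing w with
  | zero => rfl
  | succ n ih =>
    rw [List.ofFn_succ, path, ih, List.ofFn_succ]
    simp

end Path

theorem exists_ofFn_eq {α : Type*} {L : ℕ} {v : List α} (h : v.length = L) :
    ∃ x : Fin L → α, List.ofFn x = v := by
  subst h
  exact ⟨v.get, List.ofFn_get v⟩

namespace Tree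

variable {O S L : ℕ} (Γ : Tree O S L) (hL : 1 ≤ L)

/-- The tuple at a word, extended arbitrarily to words that are not nodes. -/
def tuple (w : List (Fin S)) : Fin S → Fin O :=
  if h : w.length < L then Γ ⟨w, h⟩ else Γ ⟨[], hL⟩

theorem tuple_of_lt {w : List (Fin S)} (h : w.length < L) : Γ.tuple hL w = Γ ⟨w, h⟩ := dif_pos h

theorem record_eq_path (w : Node S L) : Γ.record w = path (Γ.tuple hL) [] w.1 := by
  conv_rhs => rw [← List.ofFn_get w.1]
  rw [path_ofFn, record]
  congr 1
  funext i
  rw [List.nil_append, List.ofFn_get,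
    tuple_of_lt _ _ ((List.length_take_le _ _).trans_lt (i.isLt.trans w.2))]

theorem toCorrelation_eq_ite (a : Fin L → Fin O) (x : Fin L → Fin S) :
    Γ.toCorrelation a x =
      if (List.ofFn fun i => (a i, x i)) = path (Γ.tuple hL) [] (List.ofFn x) then 1 else 0 := by
  unfold toCorrelation
  congr 1
  rw [path_ofFn, List.ofFn_inj, funext_iff, eq_iff_iff]
  refine forall_congr' fun i => ?_
  rw [List.nil_append, tuple_of_lt _ _ ((List.length_take_le _ _).trans_lt i.isLt), nodeOf]
  simp

/-- The minimum of the two future lengths means precisely that both extended words are still nodes;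
this form avoids dependent types. -/
theorem equivalentFutures_iff (w w' : Node S L) :
    Γ.EquivalentFutures w w' ↔ ∀ u : List (Fin S), w.1.length + u.length < L →
      w'.1.length + u.length < L → Γ.tuple hL (w.1 ++ u) = Γ.tuple hL (w'.1 ++ u) := by
  have hw := w.2
  have hw' := w'.2
  rw [EquivalentFutures, funext_iff]
  constructor
  · intro h u h1 h2
    have := h ⟨u, by simp only [futureLength]; omega⟩
    rwa [tuple_of_lt _ _ (by simpa using h1), tuple_of_lt _ _ (by simpa using h2)]
  · rintro h ⟨u, hu⟩
    simp only [futureLength] at hu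
    have h1 : w.1.length + u.length < L := by omega
    have h2 : w'.1.length + u.length < L := by omega
    have := h u h1 h2
    rwa [tuple_of_lt _ _ (by simpa using h1), tuple_of_lt _ _ (by simpa using h2)] at this

end Tree

/-! ### States at the nodes -/

namespace Machine

variable {O S L d : ℕ} {M : Machine O S d} {Γ : Tree O S L} (hL : 1 ≤ L)

/-- `Realizes` speaks of records of length `L` only. A shorter record is at least as probable as its
extension to full length, which has probability one. The empty word is separate because padding
needs an input and `S` may be `0`. -/
theorem trace_iterate_path (hM : M.Realizes Γ.toCorrelation) {v : List (Fin S)}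
    (hv : v.length ≤ L) : (M.ρ * M.iterate (path (Γ.tuple hL) [] v) 1).trace = 1 := by
  cases v with
  | nil => simpa [path] using M.isDensityMatrix.2
  | cons s v =>
    refine le_antisymm (M.trace_iterate_le_one _) ?_
    obtain ⟨x, hx⟩ := exists_ofFn_eq (v := (s :: v) ++ List.replicate (L - (s :: v).length) s)
      (L := L) (by rw [List.length_append, List.length_replicate]; omega)
    have h1 := hM (fun i => Γ.tuple hL ([] ++ (List.ofFn x).take i) (x i)) x
    rw [Γ.toCorrelation_eq_ite hL, ← path_ofFn, if_pos rfl, hx, path_append] at h1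
    rw [← Complex.ofReal_one, h1]
    exact M.trace_append_le _ _

theorem isDensityMatrix_stateAfter (hL : 1 ≤ L) (hM : M.Realizes Γ.toCorrelation) (w : Node S L) :
    IsDensityMatrix (M.stateAfter (Γ.record w)) := by
  refine ⟨Matrix.nonneg_iff_posSemidef.1 (M.stateAfter_nonneg _), ?_⟩
  rw [trace_stateAfter, Γ.record_eq_path hL, trace_iterate_path hL hM w.2.le]

theorem trace_stateAfter_mul_iterate_path (hM : M.Realizes Γ.toCorrelation) (w : Node S L)
    {t : List (Fin S)} (ht : w.1.length + t.length ≤ L) :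
    (M.stateAfter (Γ.record w) * M.iterate (path (Γ.tuple hL) w.1 t) 1).trace =
      (M.stateAfter (Γ.record w)).trace := by
  rw [(isDensityMatrix_stateAfter hL hM w).2, trace_stateAfter_mul, Γ.record_eq_path hL,
    ← iterate_append,
    show path (Γ.tuple hL) w.1 t = path (Γ.tuple hL) ([] ++ w.1) t from rfl, ← path_append]
  exact trace_iterate_path hL hM (by simpa using ht)

/-- The inputs `u`, `s` on which the tuples differ define one measurement for both nodes, even at
different depths. Each node yields its own record with certainty, and the two records differ in the
last outcome. -/
theorem orthogonalRanges_stateAfter (hL : 1 ≤ L) (hM : M.Realizes Γ.toCorrelation)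
    {w w' : Node S L} (h : ¬ Γ.EquivalentFutures w w') :
    OrthogonalRanges (M.stateAfter (Γ.record w)) (M.stateAfter (Γ.record w')) := by
  rw [Γ.equivalentFutures_iff hL] at h
  push Not at h
  obtain ⟨u, hu, hu', hne⟩ := h
  obtain ⟨s, hs⟩ := Function.ne_iff.1 hne
  refine orthogonalRanges_of_effects (M.stateAfter_nonneg _) (M.stateAfter_nonneg _)
    (M.iterate_nonneg _ zero_le_one) (M.iterate_nonneg _ zero_le_one)
    (M.iterate_add_iterate_le_one (h := path (Γ.tuple hL) w.1 (u ++ [s]))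
      (h' := path (Γ.tuple hL) w'.1 (u ++ [s])) ?_ ?_)
    (trace_stateAfter_mul_iterate_path hL hM w ?_) (trace_stateAfter_mul_iterate_path hL hM w' ?_)
  · rw [map_snd_path, map_snd_path]
  · intro h
    rw [path_append, path_append] at h
    have := (List.append_inj' h rfl).2
    simp [path, hs] at this
  · simp only [List.length_append, List.length_singleton]; omega
  · simp only [List.length_append, List.length_singleton]; omega

theorem numFutures_le (hL : 1 ≤ L) (hM : M.Realizes Γ.toCorrelation) : Γ.numFutures ≤ d := by
  obtain ⟨s, hs, hpw⟩ := Γ.isGreatest_numFutures.1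
  rw [← hs, ← Fintype.card_coe]
  refine card_le_of_orthogonalRanges (fun w : s => M.stateAfter (Γ.record w.1)) ?_ ?_
  · intro w hw
    have := (isDensityMatrix_stateAfter hL hM w.1).2
    rw [hw, Matrix.trace_zero] at this
    exact zero_ne_one this
  · intro w w' hww'
    exact orthogonalRanges_stateAfter hL hM (hpw w.2 w'.2 fun h => hww' (Subtype.ext h))

end Machine

/-! ### A classical model with one state per inequivalent future -/

section KrausMap

variable {d : ℕ}

/-- The completely positive map `X ↦ ∑ j ∈ s, K jᴴ * X * K j`. -/
def krausMap {ι : Type*} (s : Finset ι) (K : ι → Matrix (Fin d) (Fin d) ℂ) :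
    Matrix (Fin d) (Fin d) ℂ →CP Matrix (Fin d) (Fin d) ℂ where
  toFun X := ∑ j ∈ s, (K j)ᴴ * X * K j
  map_add' X Y := by simp [mul_add, add_mul, Finset.sum_add_distrib]
  map_smul' c X := by simp [Finset.smul_sum]
  map_cstarMatrix_nonneg' k M hM := by
    -- Complete positivity: the amplified map is a sum of conjugations by the block-diagonal
    -- matrices `D j`.
    let D : ι → CStarMatrix (Fin k) (Fin k) (Matrix (Fin d) (Fin d) ℂ) := fun j =>
      CStarMatrix.ofMatrix (Matrix.diagonal fun _ => K j)
    have h : ∀ A : CStarMatrix (Fin k) (Fin k) (Matrix (Fin d) (Fin d) ℂ),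
        A = ∑ j ∈ s, star (D j) * M * D j → 0 ≤ A := by
      rintro A rfl
      exact Finset.sum_nonneg fun j _ => star_left_conjugate_nonneg hM (D j)
    refine h _ (CStarMatrix.ext fun i l => ?_)
    have hsum : ∀ f : ι → CStarMatrix (Fin k) (Fin k) (Matrix (Fin d) (Fin d) ℂ),
        (∑ j ∈ s, f j) i l = ∑ j ∈ s, f j i l := fun f => by
      clear h
      induction s using Finset.cons_induction with
      | empty => rfl
      | cons j s hj ih => rw [Finset.sum_cons, Finset.sum_cons, CStarMatrix.add_apply, ih]
    rw [hsum, CStarMatrix.map_apply]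
    refine Finset.sum_congr rfl fun j _ => ?_
    simp [D, CStarMatrix.mul_apply, CStarMatrix.star_apply, Matrix.diagonal_apply,
      apply_ite, ite_mul, Matrix.star_eq_conjTranspose]

theorem krausMap_apply {ι : Type*} (s : Finset ι) (K : ι → Matrix (Fin d) (Fin d) ℂ)
    (X : Matrix (Fin d) (Fin d) ℂ) : krausMap s K X = ∑ j ∈ s, (K j)ᴴ * X * K j := rfl

end KrausMap

section ClassicalMachine

variable {O S d : ℕ}

/-- The instruments with Kraus operators `|next j x⟩⟨j|`. -/
def classicalInstrument (out : Fin d → Fin S → Fin O) (next : Fin d → Fin S → Fin d)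
    (a : Fin O) (x : Fin S) : Matrix (Fin d) (Fin d) ℂ →CP Matrix (Fin d) (Fin d) ℂ :=
  krausMap ({j | out j x = a} : Finset (Fin d)) fun j => Matrix.single (next j x) j (1 : ℂ)

theorem classicalInstrument_apply (out : Fin d → Fin S → Fin O) (next : Fin d → Fin S → Fin d)
    (a : Fin O) (x : Fin S) (X : Matrix (Fin d) (Fin d) ℂ) :
    classicalInstrument out next a x X =
      ∑ j : Fin d with out j x = a, Matrix.single j j (X (next j x) (next j x)) := by
  rw [classicalInstrument, krausMap_apply]
  refine Finset.sum_congr rfl fun j _ => ?_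
  rw [Matrix.conjTranspose_single, Matrix.single_mul_mul_single]
  simp

/-- The classical deterministic measure-and-prepare model with initial state `j₀`, outcomes `out`
and transitions `next`. -/
def classicalMachine (j₀ : Fin d) (out : Fin d → Fin S → Fin O) (next : Fin d → Fin S → Fin d) :
    Machine O S d where
  ρ := Matrix.single j₀ j₀ 1
  isDensityMatrix := by
    refine ⟨?_, by simp⟩
    rw [← Matrix.diagonal_single]
    exact Matrix.PosSemidef.diagonal (Pi.single_nonneg.2 zero_le_one)
  I := classicalInstrument out next
  sum_unital x := by
    simp only [classicalInstrument_apply, Matrix.one_apply_eq]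
    rw [Finset.sum_fiberwise]
    ext i j
    rw [Matrix.sum_apply]
    simp [Matrix.single_apply, Matrix.one_apply, ite_and]

theorem isClassicalMeasurePrepare_classicalMachine (j₀ : Fin d) (out : Fin d → Fin S → Fin O)
    (next : Fin d → Fin S → Fin d) : (classicalMachine j₀ out next).IsClassicalMeasurePrepare :=
  ⟨j₀, out, next, rfl, fun _ _ _ => rfl⟩

/-- The record generated from the state `j` by the inputs. -/
def run (out : Fin d → Fin S → Fin O) (next : Fin d → Fin S → Fin d) :
    Fin d → List (Fin S) → List (Fin O × Fin S)
  | _, [] => []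
  | j, s :: t => (out j s, s) :: run out next (next j s) t

/-- Induction closes on diagonal entries: each entry after a step is zero or a diagonal entry from
before it. -/
theorem classicalMachine_iterate (j₀ : Fin d) (out : Fin d → Fin S → Fin O)
    (next : Fin d → Fin S → Fin d) (h : List (Fin O × Fin S)) (j : Fin d) :
    (classicalMachine j₀ out next).iterate h 1 j j =
      if h = run out next j (h.map Prod.snd) then 1 else 0 := by
  induction h generalizing j with
  | nil => simp [run]
  | cons ax h ih =>
    obtain ⟨a, x⟩ := ax
    rw [Machine.iterate_cons]
    change classicalInstrument out next a x _ j j = _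
    rw [classicalInstrument_apply, Matrix.sum_apply]
    simp only [Matrix.single_apply, ih, List.map_cons, run, List.cons.injEq, Prod.mk.injEq,
      and_true, and_self, Finset.sum_ite_eq', Finset.mem_filter, Finset.mem_univ, true_and]
    rw [ite_and]
    simp only [eq_comm]

theorem classicalMachine_trace (j₀ : Fin d) (out : Fin d → Fin S → Fin O)
    (next : Fin d → Fin S → Fin d) (h : List (Fin O × Fin S)) :
    ((classicalMachine j₀ out next).ρ * (classicalMachine j₀ out next).iterate h 1).trace =
      if h = run out next j₀ (h.map Prod.snd) then 1 else 0 := by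
  rw [← classicalMachine_iterate j₀]
  simp [classicalMachine, Matrix.trace_single_mul]

end ClassicalMachine

namespace Tree

variable {O S L : ℕ} (Γ : Tree O S L) (hL : 1 ≤ L)

/-- The node `v` is not above the node `w`, and the future of `v` is an initial part of the future
of `w`. -/
def Covers (w v : Node S L) : Prop :=
  w.1.length ≤ v.1.length ∧ ∀ u : List (Fin S), v.1.length + u.length < L →
    Γ.tuple hL (v.1 ++ u) = Γ.tuple hL (w.1 ++ u)

/-- Exchange argument. If `v` is uncovered, every member of `s` equivalent to it is strictly deeper.
One exists since `s` has maximum size, and replacing it by `v` lowers the total depth. -/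
theorem exists_covering : ∃ s : Finset (Node S L), s.card = Γ.numFutures ∧
    ∀ v, ∃ w ∈ s, Γ.Covers hL w v := by
  classical
  have hfin : Finite (Node S L) := (List.finite_length_lt (Fin S) L).to_subtype
  have := Fintype.ofFinite (Node S L)
  let C : Finset (Finset (Node S L)) := {s | s.card = Γ.numFutures ∧
    (s : Set (Node S L)).Pairwise fun w w' => ¬ Γ.EquivalentFutures w w'}
  have hC : C.Nonempty := by
    obtain ⟨s, hs⟩ := Γ.isGreatest_numFutures.1
    exact ⟨s, by simpa [C] using hs⟩
  obtain ⟨s, hs, hmin⟩ := C.exists_min_image (fun s => ∑ w ∈ s, w.1.length) hC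
  obtain ⟨hcard, hpw⟩ : s.card = Γ.numFutures ∧
    (s : Set (Node S L)).Pairwise fun w w' => ¬ Γ.EquivalentFutures w w' := by simpa [C] using hs
  refine ⟨s, hcard, fun v => ?_⟩
  by_contra! hv
  have hsymm : Std.Symm fun w w' : Node S L => ¬ Γ.EquivalentFutures w w' := ⟨fun w w' h h' =>
    h ((Γ.equivalentFutures_iff hL _ _).2 fun u h1 h2 =>
      ((Γ.equivalentFutures_iff hL _ _).1 h' u h2 h1).symm)⟩
  have hvs : v ∉ s := fun h => hv v h ⟨le_rfl, fun u _ => rfl⟩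
  have hlt : ∀ w ∈ s, Γ.EquivalentFutures v w → v.1.length < w.1.length := by
    intro w hw he
    by_contra! hle
    exact hv w hw ⟨hle, fun u hu =>
      (Γ.equivalentFutures_iff hL _ _).1 he u hu (by omega)⟩
  obtain ⟨w, hw, he⟩ : ∃ w ∈ s, Γ.EquivalentFutures v w := by
    by_contra! hne
    have := Γ.isGreatest_numFutures.2 ⟨insert v s, rfl, by
      rw [Finset.coe_insert]
      exact hpw.insert_of_symm fun w hw _ => hne w hw⟩
    rw [Finset.card_insert_of_notMem hvs] at this
    omega
  have hve : v ∉ s.erase w := fun h => hvs (Finset.mem_of_mem_erase h)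
  have hmem : insert v (s.erase w) ∈ C := by
    simp only [C, Finset.mem_filter, Finset.mem_univ, true_and]
    constructor
    · rw [Finset.card_insert_of_notMem hve, Finset.card_erase_add_one hw, hcard]
    · rw [Finset.coe_insert]
      -- If `v` were also equivalent to another `w'`, then, `v` being shallower than `w`, the
      -- futures of `w` and `w'` would agree through that of `v` over their whole common length.
      refine (hpw.mono (by simp)).insert_of_symm fun w' hw' _ he' => ?_
      obtain ⟨hne, hw's⟩ := Finset.mem_erase.1 (Finset.mem_coe.1 hw')
      refine hpw hw's hw hne ((Γ.equivalentFutures_iff hL _ _).2 fun u h1 h2 => ?_)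
      have h3 : v.1.length + u.length < L := by have := hlt w hw he; omega
      rw [← (Γ.equivalentFutures_iff hL _ _).1 he u h3 h2,
        ← (Γ.equivalentFutures_iff hL _ _).1 he' u h3 h1]
  have h1 := hmin _ hmem
  rw [Finset.sum_insert hve, ← Finset.add_sum_erase s _ hw] at h1
  have := hlt w hw he
  omega

theorem exists_classicalMachine (hL : 1 ≤ L) : ∃ M : Machine O S Γ.numFutures,
    M.Realizes Γ.toCorrelation ∧ M.IsClassicalMeasurePrepare := by
  obtain ⟨s, hcard, hs⟩ := Γ.exists_covering hL
  let e := s.equivFinOfCardEq hcard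
  let rep : Fin Γ.numFutures → Node S L := fun j => (e.symm j).1
  have hc : ∀ v, ∃ j, Γ.Covers hL (rep j) v := by
    intro v
    obtain ⟨w, hw, h⟩ := hs v
    exact ⟨e ⟨w, hw⟩, by simpa [rep] using h⟩
  choose c hc using hc
  let out : Fin Γ.numFutures → Fin S → Fin O := fun j => Γ (rep j)
  let next : Fin Γ.numFutures → Fin S → Fin Γ.numFutures := fun j x =>
    -- The default `j` is harmless: a representative at the last level covers only nodes at that
    -- level, after which no further input is read.
    if h : ((rep j).1 ++ [x]).length < L then c ⟨(rep j).1 ++ [x], h⟩ else j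
  have hrun : ∀ (t : List (Fin S)) (v : Node S L) (j), Γ.Covers hL (rep j) v →
      v.1.length + t.length ≤ L → run out next j t = path (Γ.tuple hL) v.1 t := by
    intro t
    induction t with
    | nil => intro v j _ _; rfl
    | cons x t ih =>
      intro v j hj hlen
      rw [List.length_cons] at hlen
      rw [run, path]
      congr 1
      · have := hj.2 [] (by simpa using v.2)
        rw [List.append_nil, List.append_nil, tuple_of_lt Γ hL (rep j).2] at this
        rw [this]
      · cases t with
        | nil => rfl
        | cons y t =>
          rw [List.length_cons] at hlen
          have h1 : (v.1 ++ [x]).length < L := by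
            rw [List.length_append, List.length_singleton]; omega
          have hj1 := hj.1
          have h2 : ((rep j).1 ++ [x]).length < L := by
            rw [List.length_append, List.length_singleton]; omega
          refine ih ⟨v.1 ++ [x], h1⟩ _ ?_ (by simp; omega)
          simp only [next, dif_pos h2]
          have hcov := hc ⟨(rep j).1 ++ [x], h2⟩
          -- Covering passes to children and composes: the new state covers the child of `rep j`,
          -- which covers the child of `v`.
          refine ⟨hcov.1.trans (by simpa using hj1), fun u hu => ?_⟩
          simp only [List.length_append, List.length_singleton] at hu
          rw [← hcov.2 u (by simp only [List.length_append, List.length_singleton]; omega)]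
          have := hj.2 (x :: u) (by rw [List.length_cons]; omega)
          simpa using this
  refine ⟨classicalMachine (c ⟨[], hL⟩) out next, fun a x => ?_,
    isClassicalMeasurePrepare_classicalMachine _ _ _⟩
  have hsnd : (List.ofFn fun i => (a i, x i)).map Prod.snd = List.ofFn x := by
    rw [List.map_ofFn]; rfl
  rw [Γ.toCorrelation_eq_ite hL, classicalMachine_trace, hsnd,
    hrun _ ⟨[], hL⟩ _ (hc _) (by simp)]
  split_ifs <;> simp

end Tree

/-! ### Extreme points are deterministic -/

section Extreme

variable {O S L : ℕ}

theorem of_one_eq_ite {P : Prop} [Decidable P] (h : (1 : ℝ) = if P then 1 else 0) : P := by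
  by_contra hP
  rw [if_neg hP] at h
  exact one_ne_zero h

/-- A distribution all of whose sequences share the first `l` entries of `a` has a deterministic
marginal. -/
theorem sum_agree_eq_ite {q : (Fin L → Fin O) → ℝ} (hq : ∑ b, q b = 1) {l : ℕ} {a : Fin L → Fin O}
    (ha : ∀ b, q b ≠ 0 → ∀ i : Fin L, (i : ℕ) < l → b i = a i) (b : Fin L → Fin O) :
    (∑ b' : Fin L → Fin O with ∀ i : Fin L, (i : ℕ) < l → b' i = b i, q b') =
      if ∀ i : Fin L, (i : ℕ) < l → a i = b i then 1 else 0 := by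
  rcases Classical.em (∀ i : Fin L, (i : ℕ) < l → a i = b i) with h | h
  · rw [if_pos h, ← hq]
    refine Finset.sum_subset (Finset.subset_univ _) fun b' _ hb' => ?_
    by_contra h0
    exact hb' (Finset.mem_filter.2 ⟨Finset.mem_univ _, fun i hi => (ha b' h0 i hi).trans (h i hi)⟩)
  · rw [if_neg h]
    refine Finset.sum_eq_zero fun b' hb' => ?_
    by_contra h0
    exact h fun i hi => (ha b' h0 i hi).symm.trans ((Finset.mem_filter.1 hb').2 i hi)

open Classical in
/-- The correlation `p`, conditioned on the event `E` of probability `c` for those input sequences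
that agree with `x` in the first `l` steps. -/
def conditioned (p : Correlation O S L) (l : ℕ) (x : Fin L → Fin S)
    (E : (Fin L → Fin O) → Prop) (c : ℝ) : Correlation O S L := fun b y =>
  if ∀ i : Fin L, (i : ℕ) < l → y i = x i then (if E b then p b y / c else 0) else p b y

open Classical in
theorem sum_conditioned {p : Correlation O S L} {l : ℕ} {x : Fin L → Fin S}
    {E : (Fin L → Fin O) → Prop} {c : ℝ} (hc : 0 < c) {y : Fin L → Fin S}
    (hEc : ∑ b with E b, p b y = c) (hy : ∀ i : Fin L, (i : ℕ) < l → y i = x i) :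
    ∑ b, conditioned p l x E c b y = 1 := by
  simp only [conditioned, if_pos hy]
  rw [← Finset.sum_filter, ← Finset.sum_div, hEc, div_self hc.ne']

open Classical in
-- Marginals up to `l` are deterministic, so conditioning does not change them. For longer ones,
-- inputs that agree so far lie both inside or both outside the conditioned region, and `E` is
-- already decided: inside, the marginal is that of `p` over `c`, or zero.
theorem conditioned_mem_polytope {p : Correlation O S L} (hp : p ∈ polytope O S L) {l : ℕ}
    {x : Fin L → Fin S} {a : Fin L → Fin O} {E : (Fin L → Fin O) → Prop} {c : ℝ} (hc : 0 < c)
    (hE : ∀ b b', (∀ i : Fin L, (i : ℕ) < l + 1 → b i = b' i) → E b → E b')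
    (hEc : ∀ y, (∀ i : Fin L, (i : ℕ) < l + 1 → y i = x i) → ∑ b with E b, p b y = c)
    (hdet : ∀ y, (∀ i : Fin L, (i : ℕ) < l + 1 → y i = x i) → ∀ b, p b y ≠ 0 →
      ∀ i : Fin L, (i : ℕ) < l → b i = a i) :
    conditioned p (l + 1) x E c ∈ polytope O S L := by
  obtain ⟨hnn, hsum, hns⟩ := hp
  have hout : ∀ y, (¬ ∀ i : Fin L, (i : ℕ) < l + 1 → y i = x i) → ∀ b,
      conditioned p (l + 1) x E c b y = p b y := fun y hy b => if_neg hy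
  refine ⟨fun b y => ?_, fun y => ?_, fun k b y y' hyy' => ?_⟩
  · unfold conditioned
    split_ifs
    · exact div_nonneg (hnn _ _) hc.le
    · exact le_rfl
    · exact hnn _ _
  · by_cases hy : ∀ i : Fin L, (i : ℕ) < l + 1 → y i = x i
    · exact sum_conditioned hc (hEc y hy) hy
    · simp only [hout y hy, hsum]
  · by_cases hk : k ≤ l
    · have key : ∀ y, marginal (conditioned p (l + 1) x E c) k b y = marginal p k b y := by
        intro y
        by_cases hy : ∀ i : Fin L, (i : ℕ) < l + 1 → y i = x i
        · unfold marginal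
          rw [sum_agree_eq_ite (hsum y) (a := a)
              fun b' hb' i hi => hdet y hy b' hb' i (hi.trans_le hk),
            sum_agree_eq_ite (sum_conditioned hc (hEc y hy) hy) (a := a)]
          intro b' hb' i hi
          refine hdet y hy b' (fun h0 => hb' ?_) i (hi.trans_le hk)
          simp [conditioned, h0]
        · simp only [marginal, hout y hy]
      rw [key, key, hns k b y y' hyy']
    · push Not at hk
      by_cases hy : ∀ i : Fin L, (i : ℕ) < l + 1 → y i = x i
      · have hy' : ∀ i : Fin L, (i : ℕ) < l + 1 → y' i = x i := fun i hi =>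
          (hyy' i (by omega)).symm.trans (hy i hi)
        have key : ∀ y, (∀ i : Fin L, (i : ℕ) < l + 1 → y i = x i) →
            marginal (conditioned p (l + 1) x E c) k b y =
              if E b then marginal p k b y / c else 0 := by
          intro y hy
          simp only [marginal, conditioned, if_pos hy]
          split_ifs with hb
          · rw [Finset.sum_div]
            refine Finset.sum_congr rfl fun b' hb' => if_pos ?_
            exact hE b b' (fun i hi => ((Finset.mem_filter.1 hb').2 i (by omega)).symm) hb
          · refine Finset.sum_eq_zero fun b' hb' => if_neg fun h => hb ?_
            exact hE b' b (fun i hi => (Finset.mem_filter.1 hb').2 i (by omega)) h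
        rw [key y hy, key y' hy', hns k b y y' hyy']
      · have hy' : ¬ ∀ i : Fin L, (i : ℕ) < l + 1 → y' i = x i := fun h => hy fun i hi =>
          (hyy' i (by omega)).trans (h i hi)
        simp only [marginal, hout y hy, hout y' hy']
        exact hns k b y y' hyy'

theorem exists_ne_zero {p : Correlation O S L} (hp : p ∈ polytope O S L) (x : Fin L → Fin S) :
    ∃ a, p a x ≠ 0 := by
  by_contra! h
  have := hp.2.1 x
  simp [h] at this

/-- The outcomes of an extreme point are determined by the inputs. -/
theorem deterministic_of_mem_extremePoints {p : Correlation O S L}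
    (hp : p ∈ Set.extremePoints ℝ (polytope O S L)) (l : ℕ) (x : Fin L → Fin S) :
    ∃ a : Fin L → Fin O, ∀ b, p b x ≠ 0 → ∀ i : Fin L, (i : ℕ) < l → b i = a i := by
  classical
  rw [mem_extremePoints_iff_left] at hp
  obtain ⟨hmem, hext⟩ := hp
  obtain ⟨hnn, hsum, hns⟩ := id hmem
  induction l generalizing x with
  | zero =>
    obtain ⟨a, -⟩ := exists_ne_zero hmem x
    exact ⟨a, fun b _ i hi => absurd hi (Nat.not_lt_zero _)⟩
  | succ l ih =>
    obtain ⟨a, ha⟩ := exists_ne_zero hmem x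
    refine ⟨a, ?_⟩
    by_contra! hcon
    obtain ⟨b₀, hb₀, i₀, hi₀, hne⟩ := hcon
    obtain ⟨a', ha'⟩ := ih x
    -- The induction hypothesis gives outcomes for each full input sequence separately; causality
    -- makes them the same for all `y` that begin like `x`.
    have hdet : ∀ y, (∀ i : Fin L, (i : ℕ) < l + 1 → y i = x i) → ∀ b, p b y ≠ 0 →
        ∀ i : Fin L, (i : ℕ) < l → b i = a i := by
      intro y hy b hb i hi
      obtain ⟨a'', ha''⟩ := ih y
      have h1 := hns l a y x fun i hi => hy i (by omega)
      unfold marginal at h1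
      rw [sum_agree_eq_ite (hsum y) ha'', sum_agree_eq_ite (hsum x) ha',
        if_pos fun i hi => (ha' a ha i hi).symm] at h1
      have h2 : ∀ i : Fin L, (i : ℕ) < l → a'' i = a i := of_one_eq_ite h1.symm
      exact (ha'' b hb i hi).trans (h2 i hi)
    let E : (Fin L → Fin O) → Prop := fun b => ∀ i : Fin L, (i : ℕ) < l + 1 → b i = a i
    have hE : ∀ b b', (∀ i : Fin L, (i : ℕ) < l + 1 → b i = b' i) → E b → E b' :=
      fun b b' h hb i hi => (h i hi).symm.trans (hb i hi)
    let α := ∑ b with E b, p b x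
    have hα : ∀ y, (∀ i : Fin L, (i : ℕ) < l + 1 → y i = x i) → ∑ b with E b, p b y = α := by
      intro y hy
      have := hns (l + 1) a y x hy
      unfold marginal at this
      convert this
    have hα' : ∀ y, (∀ i : Fin L, (i : ℕ) < l + 1 → y i = x i) →
        ∑ b with ¬ E b, p b y = 1 - α := by
      intro y hy
      rw [← hsum y, ← Finset.sum_filter_add_sum_filter_not Finset.univ E, hα y hy]
      ring
    have hpos : 0 < α := ((hnn a x).lt_of_ne' ha).trans_le
      (Finset.single_le_sum (f := fun b => p b x) (fun b _ => hnn b x)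
        (Finset.mem_filter.2 ⟨Finset.mem_univ _, fun _ _ => rfl⟩))
    have hnE : ¬ E b₀ := fun h => hne (h i₀ hi₀)
    have hpos' : 0 < 1 - α := by
      rw [← hα' x fun _ _ => rfl]
      exact ((hnn b₀ x).lt_of_ne' hb₀).trans_le
        (Finset.single_le_sum (f := fun b => p b x) (fun b _ => hnn b x)
          (Finset.mem_filter.2 ⟨Finset.mem_univ _, hnE⟩))
    have h := hext _ (conditioned_mem_polytope hmem hpos hE
        (fun y hy => by convert hα y hy) hdet) _
      (conditioned_mem_polytope (E := fun b => ¬ E b) hmem hpos'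
        (fun b b' h hb hb' => hb (hE b' b (fun i hi => (h i hi).symm) hb'))
        (fun y hy => by convert hα' y hy) hdet)
      ⟨α, 1 - α, hpos, hpos', by ring, ?_⟩
    -- Extremality equates `p` with its conditioning on `E`, which vanishes at `b₀`.
    · have := congrFun (congrFun h b₀) x
      simp only [conditioned, implies_true, if_true, if_neg hnE] at this
      exact hb₀ this.symm
    · funext b y
      simp only [Pi.add_apply, Pi.smul_apply, smul_eq_mul, conditioned]
      by_cases hy : ∀ i : Fin L, (i : ℕ) < l + 1 → y i = x i
      · by_cases hb : E b
        · rw [if_pos hy, if_pos hb, if_pos hy, if_neg (not_not.2 hb), mul_div_cancel₀ _ hpos.ne',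
            mul_zero, add_zero]
        · rw [if_pos hy, if_neg hb, if_pos hy, if_pos hb, mul_div_cancel₀ _ hpos'.ne',
            mul_zero, zero_add]
      · simp only [if_neg hy]
        ring

end Extreme

namespace Tree

variable {O S L : ℕ}

/-- An input sequence that first follows `w` and then repeats `s`. -/
def extendInputs (w : List (Fin S)) (s : Fin S) : Fin L → Fin S := fun i => w.getD i s

theorem nodeOf_extendInputs (w : Node S L) (s : Fin S) :
    nodeOf (extendInputs w.1 s) ⟨w.1.length, w.2⟩ = w := by
  have := w.2
  refine Subtype.ext (List.ext_getElem ?_ fun i h1 h2 => ?_)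
  · simp [nodeOf]; omega
  · simp [nodeOf, extendInputs, h2]

/-- Along inputs through `w` followed by `s`, the outcomes of `Γ` have probability one, also for
`Γ'`; the entry at time `w.1.length` compares the tuples. -/
theorem toCorrelation_injective :
    Function.Injective (toCorrelation : Tree O S L → Correlation O S L) := by
  intro Γ Γ' h
  funext w s
  have h1 := congrFun (congrFun h fun i => Γ (nodeOf (extendInputs w.1 s) i)
    (extendInputs w.1 s i)) (extendInputs w.1 s)
  unfold toCorrelation at h1
  rw [if_pos fun _ => rfl] at h1
  have h2 := of_one_eq_ite h1 ⟨w.1.length, w.2⟩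
  dsimp only at h2
  rw [nodeOf_extendInputs] at h2
  simpa [extendInputs] using h2

theorem exists_toCorrelation_eq {p : Correlation O S L}
    (hp : p ∈ Set.extremePoints ℝ (polytope O S L)) : ∃ Γ : Tree O S L, p = Γ.toCorrelation := by
  classical
  choose f hf using deterministic_of_mem_extremePoints hp L
  obtain ⟨hnn, hsum, hns⟩ := extremePoints_subset hp
  have hpf : ∀ a x, p a x = if ∀ i, a i = f x i then 1 else 0 := by
    intro a x
    have := sum_agree_eq_ite (hsum x) (hf x) a
    simp only [Fin.is_lt, true_imp_iff] at this
    rw [show (∑ b with ∀ i, b i = a i, p b x) = p a x by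
      simp [← funext_iff, Finset.filter_eq']] at this
    simp only [this, eq_comm]
  have hcausal : ∀ x y (l : ℕ), (∀ i : Fin L, (i : ℕ) < l → x i = y i) →
      ∀ i : Fin L, (i : ℕ) < l → f x i = f y i := by
    intro x y l hxy
    have h := hns l (f y) x y hxy
    unfold marginal at h
    rw [sum_agree_eq_ite (hsum x) fun b hb i _ => hf x b hb i i.2,
      sum_agree_eq_ite (hsum y) fun b hb i _ => hf y b hb i i.2, if_pos fun _ _ => rfl] at h
    exact of_one_eq_ite h.symm
  refine ⟨fun w s => f (extendInputs w.1 s) ⟨w.1.length, w.2⟩, ?_⟩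
  funext a x
  unfold toCorrelation
  rw [hpf]
  congr 1
  refine propext (forall_congr' fun i => ?_)
  have hi : (⟨(nodeOf x i).1.length, (nodeOf x i).2⟩ : Fin L) = i :=
    Fin.ext (by simp [nodeOf, i.2.le])
  dsimp only
  -- The outcome at `i` may depend on input `i` itself, hence `i + 1`: the word supplies the entries
  -- before `i`, and the padding supplies entry `i`.
  rw [hi, hcausal (extendInputs (nodeOf x i).1 (x i)) x (i + 1) ?_ i (Nat.lt_succ_self _)]
  intro j hj
  simp only [nodeOf, extendInputs]
  rcases Nat.lt_succ_iff_lt_or_eq.1 hj with h | h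
  · simp [List.getD_eq_getElem?_getD, h]
  · simp [List.getD_eq_getElem?_getD, Fin.ext h]

end Tree

end ArrowOfTime

end

theorem mainTheorem1 (O S L : ℕ) (hL : 1 ≤ L) (p : ArrowOfTime.Correlation O S L)
    (hp : p ∈ Set.extremePoints ℝ (ArrowOfTime.polytope O S L)) :
    (∃! Γ : ArrowOfTime.Tree O S L, p = Γ.toCorrelation) ∧
    ∀ Γ : ArrowOfTime.Tree O S L, p = Γ.toCorrelation →
      IsLeast {d : ℕ | ∃ M : ArrowOfTime.Machine O S d, M.Realizes p} Γ.numFutures ∧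
      (∀ (d : ℕ) (M : ArrowOfTime.Machine O S d), M.Realizes p →
        (∀ w : ArrowOfTime.Node S L, ArrowOfTime.IsDensityMatrix (M.stateAfter (Γ.record w))) ∧
        ∀ w w' : ArrowOfTime.Node S L, ¬ Γ.EquivalentFutures w w' →
          ArrowOfTime.OrthogonalRanges (M.stateAfter (Γ.record w))
            (M.stateAfter (Γ.record w'))) ∧
      ∃ M : ArrowOfTime.Machine O S Γ.numFutures,
        M.Realizes p ∧ M.IsClassicalMeasurePrepare := by
  constructor
  · obtain ⟨Γ, hΓ⟩ := ArrowOfTime.Tree.exists_toCorrelation_eq hp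
    exact ⟨Γ, hΓ, fun Γ' hΓ' => ArrowOfTime.Tree.toCorrelation_injective (hΓ'.symm.trans hΓ)⟩
  · rintro Γ rfl
    obtain ⟨M, hM, hcl⟩ := Γ.exists_classicalMachine hL
    exact ⟨⟨⟨M, hM⟩, fun d ⟨M', hM'⟩ => ArrowOfTime.Machine.numFutures_le hL hM'⟩,
      fun d M' hM' => ⟨ArrowOfTime.Machine.isDensityMatrix_stateAfter hL hM',
        fun w w' h => ArrowOfTime.Machine.orthogonalRanges_stateAfter hL hM' h⟩, M, hM, hcl⟩
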